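/- Let $\mathcal H$ be a complex separable Hilbert space, let $S=S^*$ be a bounded operator on $\mathcal H$ with bounded inverse, let $0\le B$ be a trace class operator on $\mathcal H$, and put $T(z)=S+zB$. Let $$\mathcal Z=\{z\in\mathbb C:\operatorname{Im}z>0\}\cup\{x\in\mathbb R: S+\tau xB\text{ has a bounded inverse for all }\tau\in[0,1]\}.$$ For a bounded dissipative operator $T$ (that is, $\operatorname{Im}T\ge 0$) with bounded inverse, define $$\log(T)=-i\int_0^\infty\big((T+is)^{-1}-(1+is)^{-1}I\big)\,ds,$$ the integral being taken in operator norm. The operator $K=B^{1/2}S^{-1}B^{1/2}$ is self-adjoint and trace class; let $\{\lambda_k\}\subset\mathbb R$ be the (at most countable) set of its distinct eigenvalues and $m_k=\dim\ker(K-\lambda_k)$ their multiplicities, which are finite for $\lambda_k\neq0$. Then, for every $z\in\mathcal Z$, the integrals defining $\log(S)$ and $\log(T(z))$ converge absolutely in operator norm, $1+\tau z\lambda_k\ne0$ for all $k$ and all $\tau\in[0,1]$, the operator $\log(T(z))-\log(S)$ is trace class, and $$\operatorname{tr}\big(\log(T(z))-\log(S)\big)=\sum_k m_k\int_0^1\frac{z\lambda_k}{1+\tau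 z\lambda_k}\,d\tau,$$ where the series converges absolutely and the term of an eigenvalue $\lambda_k=0$ (whose multiplicity may be infinite) is read as $0$. -/

import Mathlib

namespace TraceLog

universe u

variable {H : Type u} [NormedAddCommGroup H] [InnerProductSpace ℂ H] [CompleteSpace H]

/-- `T` is trace class: `∑ ⟪b i, |T| b i⟫ < ∞` for every orthonormal basis `b`, where
`|T| = (T* T)^(1/2)`. (The sum of these nonnegative terms does not depend on the basis.) -/
def IsTraceClass (T : H →L[ℂ] H) : Prop :=
  ∀ (ι : Type u) (b : HilbertBasis ι ℂ H),
    Summable fun i => (inner ℂ (b i) (CFC.abs T (b i))).re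

/-- `T` is trace class and its trace is `t`: for every orthonormal basis `b`, the series
`∑ ⟪b i, T b i⟫` converges unconditionally to `t`. -/
def HasTrace (T : H →L[ℂ] H) (t : ℂ) : Prop :=
  IsTraceClass T ∧
    ∀ (ι : Type u) (b : HilbertBasis ι ℂ H), HasSum (fun i => inner ℂ (b i) (T (b i))) t

/-- The function `s ↦ (T + i s)⁻¹ - (1 + i s)⁻¹ I` whose integral defines the logarithm. -/
noncomputable def logIntegrand (T : H →L[ℂ] H) (s : ℝ) : H →L[ℂ] H :=
  Ring.inverse (T + (Complex.I * s) • (1 : H →L[ℂ] H)) -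
    (1 + Complex.I * s)⁻¹ • (1 : H →L[ℂ] H)

/-- The integral defining `log T` makes sense: `T + i s` has a bounded inverse for every `s ≥ 0`,
and the integrand is integrable over `(0, ∞)` in operator norm. -/
def LogDefined (T : H →L[ℂ] H) : Prop :=
  (∀ s : ℝ, 0 ≤ s → IsUnit (T + (Complex.I * s) • (1 : H →L[ℂ] H))) ∧
    MeasureTheory.IntegrableOn (logIntegrand T) (Set.Ioi 0)

/-- `log T = -i ∫₀^∞ ((T + i s)⁻¹ - (1 + i s)⁻¹ I) ds`, an integral in operator norm, for `T`
bounded and dissipative with bounded inverse. -/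
noncomputable def opLog (T : H →L[ℂ] H) : H →L[ℂ] H :=
  (-Complex.I) • ∫ s in Set.Ioi (0 : ℝ), logIntegrand T s

/-- `T(z) = S + z B`. -/
def pencil (S B : H →L[ℂ] H) (z : ℂ) : H →L[ℂ] H := S + z • B

/-- The open upper half-plane, together with the real `x` such that `S + τ x B` has a bounded
inverse for all `τ ∈ [0, 1]`. -/
def admissibleSet (S B : H →L[ℂ] H) : Set ℂ :=
  {z | 0 < z.im} ∪
    {z | ∃ x : ℝ, z = x ∧
      ∀ τ : ℝ, τ ∈ Set.Icc (0 : ℝ) 1 → IsUnit (S + ((τ * x : ℝ) : ℂ) • B)}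

/-- The operator `B^(1/2) S⁻¹ B^(1/2)`. -/
noncomputable def sandwich (S B : H →L[ℂ] H) : H →L[ℂ] H :=
  CFC.sqrt B * Ring.inverse S * CFC.sqrt B

/-- The eigenvalues of a bounded operator, without repetition. -/
abbrev Eigenval (K : H →L[ℂ] H) : Type :=
  {μ : ℂ // Module.End.HasEigenvalue (K : Module.End ℂ H) μ}

/-- The eigenspace of `K` at `μ`. -/
noncomputable def eigenspaceOf (K : H →L[ℂ] H) (μ : ℂ) : Submodule ℂ H :=
  Module.End.eigenspace (K : Module.End ℂ H) μ

/-- The contribution `m ∫₀¹ z μ / (1 + τ z μ) dτ` of an eigenvalue `μ` of `K`, where `m` is the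
dimension of the eigenspace. The integral is `0` for `μ = 0`, whose multiplicity (the only one
that can be infinite) is therefore immaterial. -/
noncomputable def eigenTerm (K : H →L[ℂ] H) (z μ : ℂ) : ℂ :=
  (Module.finrank ℂ (eigenspaceOf K μ) : ℂ) * ∫ τ in (0 : ℝ)..1, z * μ / (1 + τ * z * μ)

end TraceLog

/-!
Along the segment `S + τ z B`, `0 ≤ τ ≤ 1`, the resolvents `R = (S + τ z B + i s)⁻¹` exist for all
`s ≥ 0` (`isUnitSegment_of_mem_admissibleSet`) and decay like `1 / |1 + i s|` uniformly in `τ`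
(`exists_norm_res_mul_le`). Since `∂R/∂τ = -z R B R`, the difference of the logarithms is
`i z ∫∫ R B R dτ ds`, an absolutely convergent integral in operator norm (`opLog_sub_opLog`).

With `D = B^(1/2)`, which is a Hilbert–Schmidt operator, `R B R = (R D) (D R)` is trace class with
trace norm at most `‖R‖² tr B`. This is integrable in `(τ, s)`, so the double integral is trace
class and its trace is the integral of the traces (`TraceNormBound.integral`,
`hasSum_inner_integral`). By cyclicity (`HSBound.tsum_inner_mul_comm`) the trace of `R B R` is that
of `D R² D`, and now the integral over `s` is elementary: `∂R/∂s = -i R²` gives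
`∫ R² ds = -i (S + τ z B)⁻¹` (`integral_res_mul_res`). Evaluating the trace of
`D (S + τ z B)⁻¹ D = K (1 + τ z K)⁻¹` in an orthonormal basis of eigenvectors of the compact
self-adjoint operator `K = D S⁻¹ D` (`exists_eigenbasis`, `sandwich_inverse_apply`) and collecting
equal eigenvalues (`hasSum_finrank_mul`) yields the formula.

The trace norm is handled through `TraceNormBound`, which is visibly compatible with integrals; it
implies the trace class property without a polar decomposition (`TraceNormBound.isTraceClass`).
-/

namespace TraceLog

open scoped InnerProductSpace
open ContinuousLinearMap Filter Topology MeasureTheory Set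

universe u

variable {H : Type u} [NormedAddCommGroup H] [InnerProductSpace ℂ H] [CompleteSpace H]

/-! ### Hilbert–Schmidt operators -/

/-- `A` is a Hilbert–Schmidt operator whose squared Hilbert–Schmidt norm is at most `N`:
in every orthonormal basis, the finite partial sums of `∑ ‖A bᵢ‖²` are at most `N`. -/
def HSBound (A : H →L[ℂ] H) (N : ℝ) : Prop :=
  ∀ (ι : Type u) (b : HilbertBasis ι ℂ H) (F : Finset ι), ∑ i ∈ F, ‖A (b i)‖ ^ 2 ≤ N

omit [CompleteSpace H] in
lemma hasSum_norm_inner_sq {ι : Type*} (b : HilbertBasis ι ℂ H) (x : H) :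
    HasSum (fun i => ‖⟪b i, x⟫_ℂ‖ ^ 2) (‖x‖ ^ 2) := by
  have h := (b.hasSum_inner_mul_inner x x).mapL Complex.reCLM
  have h2 : Complex.reCLM ⟪x, x⟫_ℂ = ‖x‖ ^ 2 := by
    rw [inner_self_eq_norm_sq_to_K]; norm_cast
  rw [h2] at h
  refine h.congr_fun fun i => ?_
  rw [← inner_conj_symm x (b i), Complex.conj_mul']
  norm_cast

/-- The Hilbert–Schmidt norms of `A` and of its adjoint agree, whatever bases they are
computed in. -/
lemma hsBound_adjoint_of_basis {A : H →L[ℂ] H} {N : ℝ} {ι : Type*} (b : HilbertBasis ι ℂ H)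
    (h : ∀ F : Finset ι, ∑ i ∈ F, ‖A (b i)‖ ^ 2 ≤ N) : HSBound (adjoint A) N := by
  intro κ c F
  have hs : HasSum (fun i => ∑ j ∈ F, ‖⟪b i, adjoint A (c j)⟫_ℂ‖ ^ 2)
      (∑ j ∈ F, ‖adjoint A (c j)‖ ^ 2) :=
    hasSum_sum fun j _ => hasSum_norm_inner_sq b _
  refine hs.tsum_eq ▸ hs.summable.tsum_le_of_sum_le fun G =>
    (Finset.sum_le_sum fun i _ => ?_).trans (h G)
  calc ∑ j ∈ F, ‖⟪b i, adjoint A (c j)⟫_ℂ‖ ^ 2 = ∑ j ∈ F, ‖⟪c j, A (b i)⟫_ℂ‖ ^ 2 :=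
        Finset.sum_congr rfl fun j _ => by rw [adjoint_inner_right, norm_inner_symm]
    _ ≤ ‖A (b i)‖ ^ 2 := c.orthonormal.sum_inner_products_le _

lemma HSBound.hsBound_adjoint {A : H →L[ℂ] H} {N : ℝ} (h : HSBound A N) :
    HSBound (adjoint A) N := by
  obtain ⟨w, b, -⟩ := exists_hilbertBasis ℂ H
  exact hsBound_adjoint_of_basis b (h _ b)

lemma hsBound_of_basis {A : H →L[ℂ] H} {N : ℝ} {ι : Type*} (b : HilbertBasis ι ℂ H)
    (h : ∀ F : Finset ι, ∑ i ∈ F, ‖A (b i)‖ ^ 2 ≤ N) : HSBound A N := by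
  simpa using (hsBound_adjoint_of_basis b h).hsBound_adjoint

lemma HSBound.nonneg {A : H →L[ℂ] H} {N : ℝ} (h : HSBound A N) : 0 ≤ N := by
  obtain ⟨w, b, -⟩ := exists_hilbertBasis ℂ H
  simpa using h _ b ∅

omit [CompleteSpace H] in
lemma HSBound.summable {A : H →L[ℂ] H} {N : ℝ} (h : HSBound A N) {ι : Type u}
    (b : HilbertBasis ι ℂ H) : Summable fun i => ‖A (b i)‖ ^ 2 :=
  summable_of_sum_le (fun _ => by positivity) (h ι b)

omit [CompleteSpace H] in
lemma HSBound.mono {A : H →L[ℂ] H} {M N : ℝ} (h : HSBound A M) (hMN : M ≤ N) : HSBound A N :=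
  fun ι b F => (h ι b F).trans hMN

omit [CompleteSpace H] in
lemma HSBound.mul_left {A : H →L[ℂ] H} {N : ℝ} (h : HSBound A N) (X : H →L[ℂ] H) :
    HSBound (X * A) (‖X‖ ^ 2 * N) := by
  intro ι b F
  calc ∑ i ∈ F, ‖(X * A) (b i)‖ ^ 2 ≤ ∑ i ∈ F, ‖X‖ ^ 2 * ‖A (b i)‖ ^ 2 :=
        Finset.sum_le_sum fun i _ => by
          rw [← mul_pow]; gcongr; exact X.le_opNorm _
    _ ≤ ‖X‖ ^ 2 * N := by
        rw [← Finset.mul_sum]; gcongr; exact h ι b F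

lemma HSBound.mul_right {A : H →L[ℂ] H} {N : ℝ} (h : HSBound A N) (X : H →L[ℂ] H) :
    HSBound (A * X) (‖X‖ ^ 2 * N) := by
  have := (h.hsBound_adjoint.mul_left (adjoint X)).hsBound_adjoint
  rw [LinearIsometryEquiv.norm_map] at this
  simpa [← star_eq_adjoint] using this

lemma HSBound.opNorm_sq_le {A : H →L[ℂ] H} {N : ℝ} (h : HSBound A N) : ‖A‖ ^ 2 ≤ N := by
  obtain ⟨w, b, -⟩ := exists_hilbertBasis ℂ H
  have key (x : H) : ‖A x‖ ^ 2 ≤ N * ‖x‖ ^ 2 := by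
    have hs := hasSum_norm_inner_sq b (A x)
    refine hs.tsum_eq ▸ hs.summable.tsum_le_of_sum_le fun F => ?_
    calc ∑ i ∈ F, ‖⟪b i, A x⟫_ℂ‖ ^ 2 ≤ ∑ i ∈ F, ‖adjoint A (b i)‖ ^ 2 * ‖x‖ ^ 2 :=
          Finset.sum_le_sum fun i _ => by
            rw [← adjoint_inner_left, ← mul_pow]; gcongr; exact norm_inner_le_norm _ _
      _ ≤ N * ‖x‖ ^ 2 := by
          rw [← Finset.sum_mul]; gcongr; exact h.hsBound_adjoint _ b F
  have : ‖A‖ ≤ √N := A.opNorm_le_bound (Real.sqrt_nonneg _) fun x => by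
    rw [← Real.sqrt_sq (norm_nonneg x), ← Real.sqrt_mul h.nonneg]
    exact Real.le_sqrt_of_sq_le (key x)
  calc ‖A‖ ^ 2 ≤ √N ^ 2 := by gcongr
    _ = N := Real.sq_sqrt h.nonneg

/-- Hilbert–Schmidt operators are compact: they are the limits of their truncations to finitely
many basis vectors. -/
lemma HSBound.isCompactOperator {A : H →L[ℂ] H} {N : ℝ} (h : HSBound A N) :
    IsCompactOperator A := by
  classical
  obtain ⟨w, b, -⟩ := exists_hilbertBasis ℂ H
  let T : Finset w → H →L[ℂ] H := fun F => ∑ i ∈ F, (innerSL ℂ (b i)).smulRight (A (b i))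
  have hTc (F : Finset w) : IsCompactOperator (T F) := by
    refine (compactOperator (RingHom.id ℂ) H H).sum_mem fun i _ => ?_
    exact (isCompactOperator_of_locallyCompactSpace_rng
      (toSpanSingleton ℂ (A (b i)))).comp_clm (innerSL ℂ (b i))
  -- `A - T F` vanishes on the basis vectors in `F`, so its Hilbert–Schmidt norm is a tail of a
  -- convergent series
  have hTb (F : Finset w) (i : w) : (A - T F) (b i) = if i ∈ F then 0 else A (b i) := by
    simp only [T, sub_apply, sum_apply, smulRight_apply, innerSL_apply_apply,
      orthonormal_iff_ite.1 b.orthonormal, ite_smul, one_smul, zero_smul, Finset.sum_ite_eq']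
    split_ifs <;> simp
  refine isCompactOperator_of_tendsto (l := atTop) (F := T) ?_ (Eventually.of_forall hTc)
  rw [Metric.tendsto_atTop]
  intro ε hε
  obtain ⟨F₀, hF₀⟩ := summable_iff_vanishing_norm.1 (h.summable b) ((ε / 2) ^ 2) (by positivity)
  refine ⟨F₀, fun F hF => ?_⟩
  have hb : HSBound (A - T F) ((ε / 2) ^ 2) := by
    refine hsBound_of_basis b fun G => ?_
    have h1 := hF₀ (G \ F) (Finset.sdiff_disjoint.mono_right hF)
    rw [Real.norm_of_nonneg (by positivity)] at h1
    refine le_trans (le_of_eq ?_) h1.le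
    rw [← Finset.sum_filter_add_sum_filter_not G (· ∈ F), Finset.sum_eq_zero, zero_add,
      Finset.filter_notMem_eq_sdiff]
    · refine Finset.sum_congr rfl fun i hi => ?_
      rw [hTb, if_neg (Finset.mem_sdiff.1 hi).2]
    · intro i hi
      simp [hTb, (Finset.mem_filter.1 hi).2]
  have := abs_le_of_sq_le_sq' hb.opNorm_sq_le (by positivity)
  rw [dist_comm, dist_eq_norm]
  linarith [this.2]

/-! ### A bound for the trace norm -/

/-- A way to say that the trace norm of `T` is at most `C`: in every orthonormal basis, and after
composition with the adjoint of an arbitrary contraction `V`, the diagonal entries of `V* T` have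
finite partial sums of absolute values at most `C`. This form is stable under integration in the
parameter of a family of operators, and it does not mention `|T|`. -/
def TraceNormBound (T : H →L[ℂ] H) (C : ℝ) : Prop :=
  ∀ (ι : Type u) (b : HilbertBasis ι ℂ H) (V : H →L[ℂ] H), ‖V‖ ≤ 1 → ∀ F : Finset ι,
    ∑ i ∈ F, ‖⟪V (b i), T (b i)⟫_ℂ‖ ≤ C

/-- A product of two Hilbert–Schmidt operators is trace class, in quantitative form. -/
lemma HSBound.traceNormBound {A B : H →L[ℂ] H} {M N : ℝ} (hA : HSBound A M) (hB : HSBound B N) :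
    TraceNormBound (adjoint A * B) ((M + N) / 2) := by
  intro ι b V hV F
  have hAV : HSBound (A * V) M := (hA.mul_right V).mono <|
    mul_le_of_le_one_left hA.nonneg (pow_le_one₀ (norm_nonneg _) hV)
  calc ∑ i ∈ F, ‖⟪V (b i), (adjoint A * B) (b i)⟫_ℂ‖
      ≤ ∑ i ∈ F, (‖(A * V) (b i)‖ ^ 2 + ‖B (b i)‖ ^ 2) / 2 := Finset.sum_le_sum fun i _ => by
        rw [mul_apply_eq_comp, adjoint_inner_right]
        refine (norm_inner_le_norm _ _).trans ?_
        change ‖(A * V) (b i)‖ * _ ≤ _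
        linarith [two_mul_le_add_sq ‖(A * V) (b i)‖ ‖B (b i)‖]
    _ ≤ (M + N) / 2 := by
        rw [← Finset.sum_div, Finset.sum_add_distrib]
        linarith [hAV ι b F, hB ι b F]

lemma isStrictlyPositive_add_smul_one {P : H →L[ℂ] H} (hP : 0 ≤ P) {ε : ℝ} (hε : 0 < ε) :
    IsStrictlyPositive (P + (ε : ℂ) • (1 : H →L[ℂ] H)) := by
  rw [Complex.coe_smul]
  exact IsStrictlyPositive.nonneg_add hP (isStrictlyPositive_one.smul hε)

lemma inner_apply_apply_eq_cfcAbs (T : H →L[ℂ] H) (x y : H) :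
    ⟪T x, T y⟫_ℂ = ⟪CFC.abs T x, CFC.abs T y⟫_ℂ := by
  have h := (CFC.abs_nonneg T).isSelfAdjoint.adjoint_eq
  rw [← adjoint_inner_right, ← adjoint_inner_right (CFC.abs T), h, ← mul_apply_eq_comp,
    ← mul_apply_eq_comp, CFC.abs_mul_abs, star_eq_adjoint]

lemma norm_apply_eq_norm_cfcAbs_apply (T : H →L[ℂ] H) (x : H) : ‖T x‖ = ‖CFC.abs T x‖ := by
  rw [@norm_eq_sqrt_re_inner ℂ, @norm_eq_sqrt_re_inner ℂ, inner_apply_apply_eq_cfcAbs]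

/-- The bound controls `∑ ⟪bᵢ, |T| bᵢ⟫`. Instead of the polar decomposition, the contractions
`T (|T| + ε)⁻¹` are used, for which `(T (|T| + ε)⁻¹)* T ≥ |T| - ε`; then `ε` tends to `0`. -/
lemma TraceNormBound.isTraceClass {T : H →L[ℂ] H} {C : ℝ} (h : TraceNormBound T C) :
    IsTraceClass T := by
  intro ι b
  set P := CFC.abs T with hPdef
  have hP : 0 ≤ P := CFC.abs_nonneg T
  have hP' : P.IsPositive := (nonneg_iff_isPositive P).1 hP
  have key (ε : ℝ) (hε : 0 < ε) (F : Finset ι) :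
      ∑ i ∈ F, (⟪b i, P (b i)⟫_ℂ).re ≤ C + F.card * ε := by
    set W := P + (ε : ℂ) • (1 : H →L[ℂ] H) with hW
    have hWu : IsUnit W := (isStrictlyPositive_add_smul_one hP hε).isUnit
    set Q := Ring.inverse W with hQ
    have hWQ (x : H) : P (Q x) + (ε : ℂ) • Q x = x := by
      have := congrArg (fun X : H →L[ℂ] H => X x) (Ring.mul_inverse_cancel W hWu)
      simpa only [hW, mul_apply_eq_comp, add_apply, smul_apply, one_apply_eq_self] using this
    have hPQ (x : H) : ‖P (Q x)‖ ≤ ‖x‖ := by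
      refine le_of_sq_le_sq ?_ (norm_nonneg _)
      conv_rhs => rw [← hWQ x, @norm_add_sq ℂ]
      have h1 := hP'.re_inner_nonneg_left (Q x)
      rw [inner_smul_right, RCLike.re_to_complex, Complex.re_ofReal_mul]
      rw [RCLike.re_to_complex] at h1
      have : 0 ≤ ‖(ε : ℂ) • Q x‖ ^ 2 := by positivity
      nlinarith [mul_nonneg hε.le h1]
    -- `‖T Q x‖ = ‖P Q x‖ ≤ ‖(P + ε) Q x‖ = ‖x‖`
    have hV : ‖T * Q‖ ≤ 1 := opNorm_le_bound _ zero_le_one fun x => by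
      rw [one_mul, mul_apply_eq_comp, norm_apply_eq_norm_cfcAbs_apply]
      exact hPQ x
    have hterm (i : ι) : (⟪b i, P (b i)⟫_ℂ).re ≤ ‖⟪(T * Q) (b i), T (b i)⟫_ℂ‖ + ε := by
      have h1 : ⟪(T * Q) (b i), T (b i)⟫_ℂ
          = ⟪b i, P (b i)⟫_ℂ - ε * ⟪P (Q (b i)), b i⟫_ℂ := by
        rw [hP'.inner_left_eq_inner_right, mul_apply_eq_comp, inner_apply_apply_eq_cfcAbs,
          ← hPdef, eq_sub_of_add_eq (hWQ (b i)), inner_sub_left, inner_smul_left,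
          Complex.conj_ofReal]
      have h2 : ‖⟪P (Q (b i)), b i⟫_ℂ‖ ≤ 1 := by
        refine (norm_inner_le_norm _ _).trans ?_
        rw [b.orthonormal.1 i, mul_one]
        exact (hPQ _).trans (b.orthonormal.1 i).le
      have h3 : ⟪b i, P (b i)⟫_ℂ
          = ⟪(T * Q) (b i), T (b i)⟫_ℂ + ε * ⟪P (Q (b i)), b i⟫_ℂ := by rw [h1]; ring
      calc (⟪b i, P (b i)⟫_ℂ).re ≤ ‖⟪b i, P (b i)⟫_ℂ‖ := Complex.re_le_norm _
        _ ≤ ‖⟪(T * Q) (b i), T (b i)⟫_ℂ‖ + ‖(ε : ℂ) * ⟪P (Q (b i)), b i⟫_ℂ‖ := by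
          rw [h3]; exact norm_add_le _ _
        _ ≤ _ := by
          rw [norm_mul, Complex.norm_of_nonneg hε.le]
          gcongr
          exact mul_le_of_le_one_right hε.le h2
    calc ∑ i ∈ F, (⟪b i, P (b i)⟫_ℂ).re
        ≤ ∑ i ∈ F, (‖⟪(T * Q) (b i), T (b i)⟫_ℂ‖ + ε) := Finset.sum_le_sum fun i _ => hterm i
      _ ≤ C + F.card * ε := by
        rw [Finset.sum_add_distrib, Finset.sum_const, nsmul_eq_mul]
        gcongr
        exact h ι b _ hV F
  refine summable_of_sum_le (fun i => hP'.re_inner_nonneg_right _) (c := C) fun F => ?_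
  have ht : Tendsto (fun ε : ℝ => C + F.card * ε) (𝓝[>] 0) (𝓝 C) := by
    have : Tendsto (fun ε : ℝ => C + F.card * ε) (𝓝 0) (𝓝 (C + F.card * 0)) :=
      (continuous_const.add (continuous_const.mul continuous_id)).tendsto 0
    rw [mul_zero, add_zero] at this
    exact this.mono_left nhdsWithin_le_nhds
  exact ge_of_tendsto ht (eventually_mem_nhdsWithin.mono fun ε hε => key ε hε F)

/-- A square root of a nonnegative trace class operator is Hilbert–Schmidt. -/
lemma IsTraceClass.exists_hsBound_sqrt {B : H →L[ℂ] H} (hB : 0 ≤ B) (h : IsTraceClass B) :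
    ∃ N, HSBound (CFC.sqrt B) N := by
  obtain ⟨w, b, -⟩ := exists_hilbertBasis ℂ H
  refine ⟨∑' i, (⟪b i, CFC.abs B (b i)⟫_ℂ).re, hsBound_of_basis b fun F => ?_⟩
  have hb (i : w) : (⟪b i, CFC.abs B (b i)⟫_ℂ).re = ‖CFC.sqrt B (b i)‖ ^ 2 := by
    rw [CFC.abs_of_nonneg B hB]
    conv_lhs => rw [← CFC.sqrt_mul_sqrt_self B hB]
    rw [mul_apply_eq_comp, ← adjoint_inner_left, (CFC.sqrt_nonneg B).isSelfAdjoint.adjoint_eq,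
      inner_self_eq_norm_sq_to_K]
    norm_cast
  have hs := h _ b
  simp only [hb] at hs ⊢
  exact hs.sum_le_tsum F fun i _ => by positivity

/-- The trace of a product of two Hilbert–Schmidt operators is cyclic. -/
lemma HSBound.tsum_inner_mul_comm {P Q : H →L[ℂ] H} {M N : ℝ} (hP : HSBound P M)
    (hQ : HSBound Q N) {ι κ : Type u} (b : HilbertBasis ι ℂ H) (c : HilbertBasis κ ℂ H) :
    ∑' i, ⟪b i, (P * Q) (b i)⟫_ℂ = ∑' j, ⟪c j, (Q * P) (c j)⟫_ℂ := by
  have key (A : H →L[ℂ] H) (L : ℝ) (hA : HSBound A L) :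
      Summable fun p : ι × κ => ‖⟪c p.2, A (b p.1)⟫_ℂ‖ ^ 2 := by
    refine (summable_prod_of_nonneg fun _ => by positivity).2 ⟨fun i => ?_, ?_⟩
    · exact (hasSum_norm_inner_sq c (A (b i))).summable
    · simpa only [(hasSum_norm_inner_sq c _).tsum_eq] using hA.summable b
  have hs : Summable fun p : ι × κ =>
      ⟪adjoint P (b p.1), c p.2⟫_ℂ * ⟪c p.2, Q (b p.1)⟫_ℂ := by
    refine ((key _ _ hP.hsBound_adjoint).add (key _ _ hQ)).of_norm_bounded fun p => ?_
    rw [norm_mul, norm_inner_symm]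
    nlinarith [two_mul_le_add_sq ‖⟪c p.2, adjoint P (b p.1)⟫_ℂ‖ ‖⟪c p.2, Q (b p.1)⟫_ℂ‖,
      norm_nonneg ⟪c p.2, adjoint P (b p.1)⟫_ℂ, norm_nonneg ⟪c p.2, Q (b p.1)⟫_ℂ]
  have h1 (i : ι) : ⟪b i, (P * Q) (b i)⟫_ℂ
      = ∑' j, ⟪adjoint P (b i), c j⟫_ℂ * ⟪c j, Q (b i)⟫_ℂ := by
    rw [c.tsum_inner_mul_inner, adjoint_inner_left, mul_apply_eq_comp]
  have h2 (j : κ) : ⟪c j, (Q * P) (c j)⟫_ℂ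
      = ∑' i, ⟪adjoint P (b i), c j⟫_ℂ * ⟪c j, Q (b i)⟫_ℂ := by
    rw [mul_apply_eq_comp, ← adjoint_inner_left, ← b.tsum_inner_mul_inner]
    refine tsum_congr fun i => ?_
    rw [adjoint_inner_left, adjoint_inner_left, mul_comm]
  simp only [h1, h2]
  exact (Summable.tsum_comm hs).symm

/-! ### The resolvents along the segment from `S` to `S + C` -/

/-- The operator `S + τ C + i s`. -/
noncomputable def shifted (S C : H →L[ℂ] H) (τ s : ℝ) : H →L[ℂ] H :=
  S + (τ : ℂ) • C + (Complex.I * s) • (1 : H →L[ℂ] H)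

/-- The operator `(S + τ C + i s)⁻¹` (`0` if `S + τ C + i s` has no bounded inverse). -/
noncomputable def res (S C : H →L[ℂ] H) (τ s : ℝ) : H →L[ℂ] H :=
  Ring.inverse (shifted S C τ s)

/-- `S + τ C + i s` has a bounded inverse for all `τ ∈ [0, 1]` and `s ≥ 0`. -/
def IsUnitSegment (S C : H →L[ℂ] H) : Prop :=
  ∀ τ ∈ Icc (0 : ℝ) 1, ∀ s : ℝ, 0 ≤ s → IsUnit (shifted S C τ s)

lemma continuous_shifted (S C : H →L[ℂ] H) :
    Continuous fun p : ℝ × ℝ => shifted S C p.1 p.2 := by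
  unfold shifted
  fun_prop

lemma hasDerivAt_ringInverse_comp {f : ℝ → H →L[ℂ] H} {f' : H →L[ℂ] H} {t : ℝ}
    (hf : HasDerivAt f f' t) (hu : IsUnit (f t)) :
    HasDerivAt (fun r => Ring.inverse (f r))
      (-(Ring.inverse (f t) * f' * Ring.inverse (f t))) t := by
  obtain ⟨v, hv⟩ := hu
  have h := hasFDerivAt_ringInverse (𝕜 := ℝ) v
  rw [hv] at h
  have := h.comp_hasDerivAt t hf
  rw [← hv, Ring.inverse_unit]
  simp only [neg_apply, mulLeftRight_apply] at this
  exact this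

lemma hasDerivAt_res_left {S C : H →L[ℂ] H} {τ s : ℝ} (h : IsUnit (shifted S C τ s)) :
    HasDerivAt (fun t => res S C t s) (-(res S C τ s * C * res S C τ s)) τ := by
  refine hasDerivAt_ringInverse_comp (f := fun t => shifted S C t s) ?_ h
  have h1 : HasDerivAt (fun t : ℝ => (t : ℂ) • C) ((1 : ℂ) • C) τ :=
    Complex.ofRealCLM.hasDerivAt.smul_const C
  rw [one_smul] at h1
  exact (h1.const_add S).add_const _

lemma hasDerivAt_res_right {S C : H →L[ℂ] H} {τ s : ℝ} (h : IsUnit (shifted S C τ s)) :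
    HasDerivAt (fun r => res S C τ r) (-Complex.I • (res S C τ s * res S C τ s)) s := by
  have h1 : HasDerivAt (fun r : ℝ => shifted S C τ r) (Complex.I • (1 : H →L[ℂ] H)) s := by
    have h2 : HasDerivAt (fun r : ℝ => Complex.I * (r : ℂ)) (Complex.I * 1) s :=
      Complex.ofRealCLM.hasDerivAt.const_mul _
    rw [mul_one] at h2
    exact (h2.smul_const (1 : H →L[ℂ] H)).const_add _
  have := hasDerivAt_ringInverse_comp h1 h
  simpa [res] using this

lemma continuousOn_res {S C : H →L[ℂ] H} (h : IsUnitSegment S C) :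
    ContinuousOn (fun p : ℝ × ℝ => res S C p.1 p.2) (Icc 0 1 ×ˢ Ici 0) := by
  intro p hp
  obtain ⟨v, hv⟩ := h p.1 hp.1 p.2 hp.2
  have h1 : ContinuousAt Ring.inverse (shifted S C p.1 p.2) :=
    hv ▸ NormedRing.inverse_continuousAt v
  exact (ContinuousAt.comp (f := fun p : ℝ × ℝ => shifted S C p.1 p.2) h1
    (continuous_shifted S C).continuousAt).continuousWithinAt

lemma norm_one_add_I_mul_sq (s : ℝ) : ‖1 + Complex.I * s‖ ^ 2 = 1 + s ^ 2 := by
  rw [mul_comm, ← Complex.ofReal_one, Complex.norm_add_mul_I, Real.sq_sqrt (by positivity)]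
  ring

/-- The resolvents decay like `1 / |1 + i s|`, uniformly along the segment. -/
lemma exists_norm_res_mul_le {S C : H →L[ℂ] H} (h : IsUnitSegment S C) :
    ∃ K : ℝ, 0 ≤ K ∧ ∀ τ ∈ Icc (0 : ℝ) 1, ∀ s : ℝ, 0 ≤ s →
      ‖res S C τ s‖ * ‖1 + Complex.I * s‖ ≤ K := by
  -- compactness bounds the resolvents for `s ≤ M`; for `s ≥ M`, the term `i s` dominates `S + τ C`
  set M : ℝ := 2 * (‖S‖ + ‖C‖) + 1 with hM
  have hM1 : 1 ≤ M := by
    have := norm_nonneg S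
    have := norm_nonneg C
    linarith
  have hcont : ContinuousOn (fun p : ℝ × ℝ => ‖res S C p.1 p.2‖ * ‖1 + Complex.I * p.2‖)
      (Icc 0 1 ×ˢ Icc 0 M) :=
    ((continuousOn_res h).mono (prod_mono_right Icc_subset_Ici_self)).norm.mul
      (Continuous.continuousOn (by fun_prop))
  obtain ⟨K, hK⟩ := (isCompact_Icc.prod isCompact_Icc).bddAbove_image hcont
  refine ⟨max K 4, by positivity, fun τ hτ s hs => ?_⟩
  rcases le_total s M with hsM | hsM
  · exact (hK ⟨(τ, s), ⟨hτ, hs, hsM⟩, rfl⟩).trans (le_max_left _ _)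
  refine le_trans ?_ (le_max_right _ _)
  set R := res S C τ s with hR
  -- `i s R = 1 - (S + τ C) R`, and `‖S + τ C‖ ≤ s / 2`
  have hR1 : (Complex.I * s) • R = 1 - (S + (τ : ℂ) • C) * R := by
    have := Ring.mul_inverse_cancel _ (h τ hτ s hs)
    rw [← this]
    change _ = shifted S C τ s * R - _
    rw [shifted, add_mul _ _ R, smul_mul_assoc, one_mul]
    abel
  have hT : ‖S + (τ : ℂ) • C‖ ≤ s / 2 := by
    refine (norm_add_le _ _).trans ?_
    rw [norm_smul, Complex.norm_of_nonneg hτ.1]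
    have := mul_le_of_le_one_left (norm_nonneg C) hτ.2
    linarith
  have h1 : s * ‖R‖ ≤ 1 + s / 2 * ‖R‖ := by
    calc s * ‖R‖ = ‖(Complex.I * s) • R‖ := by
          rw [norm_smul, norm_mul, Complex.norm_I, one_mul, Complex.norm_of_nonneg hs]
      _ ≤ ‖(1 : H →L[ℂ] H)‖ + ‖(S + (τ : ℂ) • C) * R‖ := by rw [hR1]; exact norm_sub_le _ _
      _ ≤ 1 + s / 2 * ‖R‖ := by
          gcongr
          · exact norm_id_le
          · exact (norm_mul_le _ _).trans (by gcongr)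
  have h2 : ‖1 + Complex.I * s‖ ≤ 2 * s := by
    refine (norm_add_le _ _).trans ?_
    rw [norm_one, norm_mul, Complex.norm_I, one_mul, Complex.norm_of_nonneg hs]
    linarith
  calc ‖R‖ * ‖1 + Complex.I * s‖ ≤ ‖R‖ * (2 * s) := by gcongr
    _ ≤ 4 := by linarith

lemma exists_norm_res_sq_le {S C : H →L[ℂ] H} (h : IsUnitSegment S C) :
    ∃ K : ℝ, 0 ≤ K ∧ ∀ τ ∈ Icc (0 : ℝ) 1, ∀ s : ℝ, 0 ≤ s →
      ‖res S C τ s‖ ^ 2 ≤ K * (1 + s ^ 2)⁻¹ := by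
  obtain ⟨K, hK0, hK⟩ := exists_norm_res_mul_le h
  refine ⟨K ^ 2, by positivity, fun τ hτ s hs => ?_⟩
  rw [← div_eq_mul_inv, le_div_iff₀ (by positivity), ← norm_one_add_I_mul_sq, ← mul_pow]
  exact pow_le_pow_left₀ (by positivity) (hK τ hτ s hs) 2

lemma logDefined_of_isUnit {T : H →L[ℂ] H}
    (h : ∀ s : ℝ, 0 ≤ s → IsUnit (T + (Complex.I * s) • (1 : H →L[ℂ] H))) : LogDefined T := by
  have hseg : IsUnitSegment T 0 := fun τ _ s hs => by simpa [shifted] using h s hs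
  have hres (s : ℝ) : Ring.inverse (T + (Complex.I * s) • (1 : H →L[ℂ] H)) = res T 0 0 s := by
    simp [res, shifted]
  obtain ⟨K, hK0, hK⟩ := exists_norm_res_mul_le hseg
  refine ⟨h, ?_⟩
  have hne (s : ℝ) : 1 + Complex.I * s ≠ 0 := fun h0 => by
    have := norm_one_add_I_mul_sq s
    rw [h0, norm_zero] at this
    nlinarith [sq_nonneg s]
  have hmeas : AEStronglyMeasurable (logIntegrand T) (volume.restrict (Ioi 0)) := by
    refine ContinuousOn.aestronglyMeasurable ?_ measurableSet_Ioi
    unfold logIntegrand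
    simp only [hres]
    refine ContinuousOn.sub ?_ (Continuous.continuousOn ?_)
    · exact (continuousOn_res hseg).comp (f := fun s : ℝ => ((0 : ℝ), s)) (by fun_prop)
        fun s hs => ⟨by simp, mem_Ici.2 (le_of_lt hs)⟩
    · exact (Continuous.inv₀ (by fun_prop) hne).smul continuous_const
  refine (integrable_inv_one_add_sq.integrableOn.const_mul (K * ‖1 - T‖)).mono' hmeas ?_
  refine (ae_restrict_iff' measurableSet_Ioi).2 (Eventually.of_forall fun s hs => ?_)
  have hs0 : 0 ≤ s := le_of_lt hs
  -- by the resolvent identity, the integrand is `(1 + i s)⁻¹ (T + i s)⁻¹ (1 - T)`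
  have hid : logIntegrand T s = (1 + Complex.I * s)⁻¹ • (res T 0 0 s * (1 - T)) := by
    have h1 : res T 0 0 s * (T + (Complex.I * s) • (1 : H →L[ℂ] H)) = 1 := by
      rw [← hres]; exact Ring.inverse_mul_cancel _ (h s hs0)
    have h2 : res T 0 0 s * (1 - T) = (1 + Complex.I * s) • res T 0 0 s - 1 := by
      conv_rhs => rw [← h1]
      rw [mul_sub, mul_add, mul_one, mul_smul_comm, mul_one, add_smul, one_smul]
      abel
    rw [h2, smul_sub, inv_smul_smul₀ (hne s), logIntegrand, hres]
  have hpos : 0 < ‖1 + Complex.I * s‖ := norm_pos_iff.2 (hne s)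
  rw [hid, norm_smul, norm_inv, ← norm_one_add_I_mul_sq]
  calc ‖1 + Complex.I * s‖⁻¹ * ‖res T 0 0 s * (1 - T)‖
      ≤ ‖1 + Complex.I * s‖⁻¹ * ((K * ‖1 + Complex.I * s‖⁻¹) * ‖1 - T‖) := by
        gcongr
        refine (norm_mul_le _ _).trans ?_
        gcongr
        rw [← div_eq_mul_inv, le_div_iff₀ hpos]
        exact hK 0 (by simp) s hs0
    _ = K * ‖1 - T‖ * (‖1 + Complex.I * s‖ ^ 2)⁻¹ := by
        rw [sq, mul_inv]; ring

/-- The measure `dτ ds` on `(0, 1] × (0, ∞)`. -/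
noncomputable def stripMeasure : Measure (ℝ × ℝ) :=
  (volume.restrict (Ioc 0 1)).prod (volume.restrict (Ioi 0))

instance : SFinite stripMeasure := by unfold stripMeasure; infer_instance

lemma stripMeasure_eq_restrict :
    stripMeasure = volume.restrict (Ioc (0 : ℝ) 1 ×ˢ Ioi (0 : ℝ)) := by
  rw [stripMeasure, Measure.prod_restrict]; rfl

lemma ae_stripMeasure {p : ℝ × ℝ → Prop} (h : ∀ τ ∈ Icc (0 : ℝ) 1, ∀ s : ℝ, 0 ≤ s → p (τ, s)) :
    ∀ᵐ x ∂stripMeasure, p x := by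
  rw [stripMeasure_eq_restrict]
  refine (ae_restrict_iff' (measurableSet_Ioc.prod measurableSet_Ioi)).2
    (Eventually.of_forall fun x hx => h x.1 ⟨hx.1.1.le, hx.1.2⟩ x.2 (le_of_lt hx.2))

lemma integrable_stripMeasure_inv_one_add_sq :
    Integrable (fun p : ℝ × ℝ => (1 + p.2 ^ 2)⁻¹) stripMeasure :=
  (integrable_inv_one_add_sq.integrableOn (s := Ioi (0 : ℝ))).integrable.comp_snd _

lemma integrable_stripMeasure {E : Type*} [NormedAddCommGroup E] {f : ℝ × ℝ → E} {K : ℝ}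
    (hf : ContinuousOn f (Icc 0 1 ×ˢ Ici 0))
    (hK : ∀ τ ∈ Icc (0 : ℝ) 1, ∀ s : ℝ, 0 ≤ s → ‖f (τ, s)‖ ≤ K * (1 + s ^ 2)⁻¹) :
    Integrable f stripMeasure := by
  refine (integrable_stripMeasure_inv_one_add_sq.const_mul K).mono' ?_ (ae_stripMeasure hK)
  rw [stripMeasure_eq_restrict]
  exact (hf.mono (prod_mono Ioc_subset_Icc_self Ioi_subset_Ici_self)).aestronglyMeasurable
    (measurableSet_Ioc.prod measurableSet_Ioi)

lemma integrable_res_mul_res {S C : H →L[ℂ] H} (h : IsUnitSegment S C) (X : H →L[ℂ] H) :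
    Integrable (fun p : ℝ × ℝ => res S C p.1 p.2 * X * res S C p.1 p.2) stripMeasure := by
  obtain ⟨K, hK0, hK⟩ := exists_norm_res_sq_le h
  refine integrable_stripMeasure (K := ‖X‖ * K)
    (((continuousOn_res h).mul continuousOn_const).mul (continuousOn_res h)) fun τ hτ s hs => ?_
  calc ‖res S C τ s * X * res S C τ s‖ ≤ ‖res S C τ s‖ * ‖X‖ * ‖res S C τ s‖ :=
        (norm_mul_le _ _).trans (by gcongr; exact norm_mul_le _ _)
    _ = ‖X‖ * ‖res S C τ s‖ ^ 2 := by ring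
    _ ≤ ‖X‖ * K * (1 + s ^ 2)⁻¹ := by
        rw [mul_assoc]; gcongr; exact hK τ hτ s hs

/-- The difference of the logarithms, by integrating the derivative of the resolvent along the
segment from `S` to `S + C`. -/
lemma opLog_sub_opLog {S C : H →L[ℂ] H} (h : IsUnitSegment S C) :
    opLog (S + C) - opLog S =
      Complex.I • ∫ p, res S C p.1 p.2 * C * res S C p.1 p.2 ∂stripMeasure := by
  have h0 : LogDefined S := logDefined_of_isUnit fun s hs => by
    simpa [shifted] using h 0 (by simp) s hs
  have h1 : LogDefined (S + C) := logDefined_of_isUnit fun s hs => by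
    simpa [shifted] using h 1 (by simp) s hs
  have hint := integrable_res_mul_res h C
  rw [opLog, opLog, ← smul_sub, ← integral_sub h1.2 h0.2, stripMeasure, integral_prod_symm _ hint,
    neg_smul, ← smul_neg, ← integral_neg]
  congr 1
  refine setIntegral_congr_fun measurableSet_Ioi fun s hs => ?_
  have hs0 : 0 ≤ s := le_of_lt hs
  have hcont : ContinuousOn (fun τ => res S C τ s * C * res S C τ s) (Icc 0 1) := by
    have : ContinuousOn (fun τ => res S C τ s) (Icc 0 1) :=
      (continuousOn_res h).comp (f := fun τ : ℝ => (τ, s)) (by fun_prop) fun τ hτ => ⟨hτ, hs0⟩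
    exact (this.mul continuousOn_const).mul this
  have hft := intervalIntegral.integral_eq_sub_of_hasDerivAt (a := 0) (b := 1)
    (f := fun τ => res S C τ s) (f' := fun τ => -(res S C τ s * C * res S C τ s))
    (fun τ hτ => hasDerivAt_res_left (h τ (by rwa [uIcc_of_le zero_le_one] at hτ) s hs0))
    (ContinuousOn.intervalIntegrable (by rw [uIcc_of_le zero_le_one]; exact hcont.neg))
  rw [intervalIntegral.integral_neg, intervalIntegral.integral_of_le zero_le_one] at hft
  have e0 : res S C 0 s = Ring.inverse (S + (Complex.I * s) • (1 : H →L[ℂ] H)) := by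
    simp [res, shifted]
  have e1 : res S C 1 s = Ring.inverse (S + C + (Complex.I * s) • (1 : H →L[ℂ] H)) := by
    simp [res, shifted]
  simp only [logIntegrand]
  rw [← neg_inj, hft, e0, e1]
  abel

/-- An antiderivative of `R²` in `s` is `i R`, which vanishes at infinity. -/
lemma integral_res_mul_res {S C : H →L[ℂ] H} (h : IsUnitSegment S C) {τ : ℝ}
    (hτ : τ ∈ Icc (0 : ℝ) 1) :
    IntegrableOn (fun s => res S C τ s * res S C τ s) (Ioi 0) ∧
    ∫ s in Ioi 0, res S C τ s * res S C τ s = -Complex.I • res S C τ 0 := by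
  obtain ⟨K, hK0, hK⟩ := exists_norm_res_sq_le h
  have hcont : ContinuousOn (fun s => res S C τ s) (Ici 0) :=
    (continuousOn_res h).comp (f := fun s : ℝ => (τ, s)) (by fun_prop) fun s hs => ⟨hτ, hs⟩
  have hint : IntegrableOn (fun s => res S C τ s * res S C τ s) (Ioi 0) := by
    refine (integrable_inv_one_add_sq.integrableOn.const_mul K).mono'
      (((hcont.mul hcont).mono Ioi_subset_Ici_self).aestronglyMeasurable measurableSet_Ioi) ?_
    refine (ae_restrict_iff' measurableSet_Ioi).2 (Eventually.of_forall fun s hs => ?_)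
    refine (norm_mul_le _ _).trans ?_
    rw [← sq]
    exact hK τ hτ s (le_of_lt hs)
  refine ⟨hint, ?_⟩
  have hlim : Tendsto (fun s => res S C τ s) atTop (𝓝 0) := by
    have h1 : Tendsto (fun s : ℝ => K * (1 + s ^ 2)⁻¹) atTop (𝓝 0) := by
      have : Tendsto (fun s : ℝ => 1 + s ^ 2) atTop atTop :=
        tendsto_atTop_add_const_left _ _ (tendsto_pow_atTop two_ne_zero)
      simpa using this.inv_tendsto_atTop.const_mul K
    have h2 : Tendsto (fun s => ‖res S C τ s‖ ^ 2) atTop (𝓝 0) :=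
      squeeze_zero' (Eventually.of_forall fun s => by positivity)
        ((eventually_ge_atTop 0).mono fun s hs => hK τ hτ s hs) h1
    rw [tendsto_zero_iff_norm_tendsto_zero]
    simpa using h2.sqrt
  have := integral_Ioi_of_hasDerivAt_of_tendsto'
    (fun s hs => hasDerivAt_res_right (h τ hτ s hs)) (hint.smul (-Complex.I)) hlim
  rw [integral_smul, zero_sub] at this
  rw [neg_smul, ← smul_neg, ← this, smul_smul]
  simp

/-! ### Invertibility in the closed upper half-plane -/

/-- An operator with strictly positive imaginary part is invertible: up to congruence by the square
root of the imaginary part, it is `X + i` with `X` self-adjoint. -/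
lemma isUnit_add_I_smul {A P : H →L[ℂ] H} (hA : IsSelfAdjoint A) (hP : IsStrictlyPositive P) :
    IsUnit (A + Complex.I • P) := by
  set q := CFC.sqrt P with hq
  have hqu : IsUnit q := hP.isUnit_cfcSqrt
  have hqs : IsSelfAdjoint q := (CFC.sqrt_nonneg P).isSelfAdjoint
  set r := Ring.inverse q with hr
  have hqr : q * r = 1 := Ring.mul_inverse_cancel _ hqu
  have hrq : r * q = 1 := Ring.inverse_mul_cancel _ hqu
  have hrs : IsSelfAdjoint r := by
    rw [isSelfAdjoint_iff, hr, ← Ring.inverse_star, hqs.star_eq]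
  have hX : IsSelfAdjoint (r * A * r) := by
    simpa [hrs.star_eq] using hA.conjugate r
  have hu : IsUnit (r * A * r + Complex.I • 1) := by
    have h1 : -Complex.I ∉ spectrum ℂ (r * A * r) := fun h => by
      simpa using hX.im_eq_zero_of_mem_spectrum h
    rw [spectrum.notMem_iff, Algebra.algebraMap_eq_smul_one] at h1
    simpa [neg_smul, add_comm] using h1.neg
  have : A + Complex.I • P = q * (r * A * r + Complex.I • 1) * q := by
    have h2 : q * (r * A * r) * q = A := by
      calc q * (r * A * r) * q = (q * r) * A * (r * q) := by simp only [mul_assoc]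
        _ = A := by rw [hqr, hrq, one_mul, mul_one]
    rw [mul_add, add_mul, h2, mul_smul_comm, mul_one, smul_mul_assoc,
      CFC.sqrt_mul_sqrt_self P hP.nonneg]
  rw [this]
  exact (hqu.mul hu).mul hqu

section Pencil

variable {S B : H →L[ℂ] H}

lemma isSelfAdjoint_sandwich (hS : IsSelfAdjoint S) : IsSelfAdjoint (sandwich S B) := by
  have hD : IsSelfAdjoint (CFC.sqrt B) := (CFC.sqrt_nonneg B).isSelfAdjoint
  have hSi : IsSelfAdjoint (Ring.inverse S) := by
    rw [isSelfAdjoint_iff, ← Ring.inverse_star, hS.star_eq]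
  simpa [hD.star_eq, sandwich] using hSi.conjugate (CFC.sqrt B)

/-- For nonreal `w`, the operator `S + w B` is invertible if and only if `1 + w K` is, where
`K = B^(1/2) S⁻¹ B^(1/2)` has real spectrum. -/
lemma isUnit_add_smul_of_im_ne_zero (hS : IsSelfAdjoint S) (hSinv : IsUnit S) (hB : 0 ≤ B) {w : ℂ}
    (hw : w.im ≠ 0) : IsUnit (S + w • B) := by
  have hw0 : w ≠ 0 := fun h => hw (by simp [h])
  let r : ℂˣ := Units.mk0 (-w⁻¹) (by simpa using hw0)
  have hr : (r : ℂ) ∉ spectrum ℂ (CFC.sqrt B * (Ring.inverse S * CFC.sqrt B)) := fun h => by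
    rw [← mul_assoc] at h
    have h1 := (isSelfAdjoint_sandwich hS).im_eq_zero_of_mem_spectrum h
    have h2 : (w⁻¹).im = 0 := by simpa [r] using h1
    rw [Complex.inv_im, div_eq_zero_iff] at h2
    rcases h2 with h2 | h2
    · exact hw (by simpa using h2)
    · exact hw0 (by simpa using h2)
  rw [spectrum.unit_mem_mul_comm, mul_assoc, CFC.sqrt_mul_sqrt_self B hB, spectrum.notMem_iff,
    Algebra.algebraMap_eq_smul_one] at hr
  have h1 : (-w) • (S * ((r : ℂ) • 1 - Ring.inverse S * B)) = S + w • B := by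
    rw [mul_sub, ← mul_assoc, Ring.mul_inverse_cancel _ hSinv, one_mul, mul_smul_comm, mul_one,
      smul_sub, smul_smul]
    simp [r, hw0]
  rw [← h1]
  exact (hSinv.mul hr).smul (Units.mk0 (-w) (neg_ne_zero.2 hw0))

lemma isUnitSegment_of_mem_admissibleSet (hS : IsSelfAdjoint S) (hSinv : IsUnit S) (hB : 0 ≤ B)
    {z : ℂ} (hz : z ∈ admissibleSet S B) : IsUnitSegment S (z • B) := by
  intro τ hτ s hs
  have hBs : IsSelfAdjoint B := hB.isSelfAdjoint
  have him : 0 ≤ z.im := by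
    rcases hz with hz | ⟨x, rfl, -⟩
    · exact le_of_lt hz
    · simp
  -- for `s > 0` the imaginary part is at least `s`; at `s = 0` it may degenerate
  rcases hs.eq_or_lt with rfl | hs
  · have e : shifted S (z • B) τ 0 = S + (τ * z) • B := by simp [shifted, smul_smul]
    rw [e]
    rcases hz with hz | ⟨x, rfl, hx⟩
    · rcases hτ.1.eq_or_lt with rfl | hτ0
      · simpa using hSinv
      · refine isUnit_add_smul_of_im_ne_zero hS hSinv hB ?_
        rw [Complex.im_ofReal_mul]
        exact (mul_pos hτ0 hz).ne'
    · simpa using hx τ hτ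
  · have hP : 0 ≤ ((τ * z.im : ℝ) : ℂ) • B := by
      rw [Complex.coe_smul]
      exact smul_nonneg (mul_nonneg hτ.1 him) hB
    have hA : IsSelfAdjoint (S + ((τ * z.re : ℝ) : ℂ) • B) :=
      hS.add (IsSelfAdjoint.smul (Complex.conj_ofReal _) hBs)
    have e : shifted S (z • B) τ s = S + ((τ * z.re : ℝ) : ℂ) • B +
        Complex.I • (((τ * z.im : ℝ) : ℂ) • B + (s : ℂ) • (1 : H →L[ℂ] H)) := by
      have hz' : (τ : ℂ) * z = ((τ * z.re : ℝ) : ℂ) + Complex.I * ((τ * z.im : ℝ) : ℂ) := by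
        conv_lhs => rw [← Complex.re_add_im z]
        push_cast
        ring
      rw [shifted, smul_smul, hz', add_smul, smul_add, smul_smul, smul_smul]
      abel
    rw [e]
    exact isUnit_add_I_smul hA (isStrictlyPositive_add_smul_one hP hs)

omit [CompleteSpace H] in
/-- An eigenvector `x` of `K = D S⁻¹ D` to the eigenvalue `l` satisfies
`(1 + w l) D (S + w D²)⁻¹ D x = l x`, as `(S + w D²) S⁻¹ D x = (1 + w l) D x`. -/
lemma sandwich_inverse_apply {D : H →L[ℂ] H} (hSinv : IsUnit S) {w l : ℂ} {x : H}
    (hu : IsUnit (S + w • (D * D))) (hx : (D * Ring.inverse S * D) x = l • x) :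
    (1 + w * l) • D (Ring.inverse (S + w • (D * D)) (D x)) = l • x := by
  set R := Ring.inverse (S + w • (D * D)) with hR
  have h1 : S (Ring.inverse S (D x)) = D x :=
    congrArg (fun X : H →L[ℂ] H => X (D x)) (Ring.mul_inverse_cancel S hSinv)
  have h2 : (S + w • (D * D)) (Ring.inverse S (D x)) = (1 + w * l) • D x := by
    have h3 : D (D (Ring.inverse S (D x))) = l • D x := by
      rw [← map_smul, ← hx]; rfl
    simp only [add_apply, smul_apply, mul_apply_eq_comp, h1, h3, add_smul, one_smul, mul_smul]
  have h4 : R ((S + w • (D * D)) (Ring.inverse S (D x))) = Ring.inverse S (D x) :=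
    congrArg (fun X : H →L[ℂ] H => X (Ring.inverse S (D x))) (Ring.inverse_mul_cancel _ hu)
  rw [h2, map_smul] at h4
  rw [← map_smul, h4, ← hx]
  rfl

omit [CompleteSpace H] in
lemma one_add_mul_ne_zero {D : H →L[ℂ] H} (hSinv : IsUnit S) {w l : ℂ} {x : H} (hx0 : x ≠ 0)
    (hu : IsUnit (S + w • (D * D))) (hx : (D * Ring.inverse S * D) x = l • x) : 1 + w * l ≠ 0 := by
  intro h0
  have h := sandwich_inverse_apply hSinv hu hx
  rw [h0, zero_smul, eq_comm, smul_eq_zero_iff_left hx0] at h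
  simp [h] at h0

end Pencil

/-! ### Traces of integrals -/

omit [CompleteSpace H] in
lemma countable_of_hilbertBasis [TopologicalSpace.SeparableSpace H] {ι : Type*}
    (b : HilbertBasis ι ℂ H) : Countable ι := by
  refine Pairwise.countable_of_isOpen_disjoint (s := fun i => Metric.ball (b i) (1 / 2)) ?_
    (fun _ => Metric.isOpen_ball) fun i => ⟨b i, Metric.mem_ball_self (by norm_num)⟩
  intro i j hij
  refine Metric.ball_disjoint_ball ?_
  have h1 : ‖b i - b j‖ ^ 2 = 2 := by
    rw [@norm_sub_sq ℂ, b.orthonormal.2 hij, b.orthonormal.1, b.orthonormal.1]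
    norm_num
  rw [dist_eq_norm]
  nlinarith [norm_nonneg (b i - b j)]

/-- The functional `T ↦ ⟪x, T y⟫`. -/
noncomputable def entry (x y : H) : (H →L[ℂ] H) →L[ℂ] ℂ :=
  (innerSL ℂ x).comp (ContinuousLinearMap.apply ℂ H y)

section Integral

variable {α : Type*} [MeasurableSpace α] {μ : Measure α} {f : α → H →L[ℂ] H} {C : α → ℝ}

lemma inner_integral_apply (hf : Integrable f μ) (x y : H) :
    ⟪x, (∫ a, f a ∂μ) y⟫_ℂ = ∫ a, ⟪x, f a y⟫_ℂ ∂μ :=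
  ((entry x y).integral_comp_comm hf).symm

lemma integrable_inner_apply (hf : Integrable f μ) (x y : H) :
    Integrable (fun a => ⟪x, f a y⟫_ℂ) μ :=
  (entry x y).integrable_comp hf

lemma sum_integral_norm_inner_le (hf : Integrable f μ) (hC : Integrable C μ)
    (h : ∀ᵐ a ∂μ, TraceNormBound (f a) (C a)) {ι : Type u} (b : HilbertBasis ι ℂ H)
    {V : H →L[ℂ] H} (hV : ‖V‖ ≤ 1) (F : Finset ι) :
    ∑ i ∈ F, ∫ a, ‖⟪V (b i), f a (b i)⟫_ℂ‖ ∂μ ≤ ∫ a, C a ∂μ := by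
  rw [← integral_finsetSum _ fun i _ => (integrable_inner_apply hf _ _).norm]
  exact integral_mono_ae (integrable_finsetSum _ fun i _ => (integrable_inner_apply hf _ _).norm) hC
    (h.mono fun a ha => ha ι b V hV F)

lemma TraceNormBound.integral (hf : Integrable f μ) (hC : Integrable C μ)
    (h : ∀ᵐ a ∂μ, TraceNormBound (f a) (C a)) : TraceNormBound (∫ a, f a ∂μ) (∫ a, C a ∂μ) := by
  intro ι b V hV F
  refine (Finset.sum_le_sum fun i _ => ?_).trans (sum_integral_norm_inner_le hf hC h b hV F)
  rw [inner_integral_apply hf]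
  exact norm_integral_le_integral_norm _

omit [CompleteSpace H] in
lemma TraceNormBound.smul {T : H →L[ℂ] H} {M : ℝ} (h : TraceNormBound T M) (k : ℂ) :
    TraceNormBound (k • T) (‖k‖ * M) := by
  intro ι b V hV F
  simp only [smul_apply, inner_smul_right, norm_mul, ← Finset.mul_sum]
  gcongr
  exact h ι b V hV F

/-- The trace of an integral of trace class operators is the integral of the traces. -/
lemma hasSum_inner_integral [TopologicalSpace.SeparableSpace H] (hf : Integrable f μ)
    (hC : Integrable C μ) (h : ∀ᵐ a ∂μ, TraceNormBound (f a) (C a)) {ι : Type u}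
    (b : HilbertBasis ι ℂ H) :
    HasSum (fun i => ⟪b i, (∫ a, f a ∂μ) (b i)⟫_ℂ) (∫ a, ∑' i, ⟪b i, f a (b i)⟫_ℂ ∂μ) := by
  have := countable_of_hilbertBasis b
  simp only [inner_integral_apply hf]
  refine hasSum_integral_of_summable_integral_norm (fun i => integrable_inner_apply hf _ _) ?_
  refine summable_of_sum_le (c := ∫ a, C a ∂μ)
    (fun i => integral_nonneg fun _ => norm_nonneg _) fun F => ?_
  exact sum_integral_norm_inner_le (V := 1) hf hC h b norm_id_le F

end Integral

/-! ### Eigenbases of compact self-adjoint operators -/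

/-- A compact self-adjoint operator has an orthonormal basis of eigenvectors, indexed by its
eigenvalues and, for each of them, by an orthonormal basis of the eigenspace. -/
lemma exists_eigenbasis {K : H →L[ℂ] H} (hK : IsCompactOperator K) (hKs : IsSelfAdjoint K) :
    ∃ (w : ∀ μ : Eigenval K, Set (eigenspaceOf K μ))
      (b : ∀ μ : Eigenval K, HilbertBasis (w μ) ℂ (eigenspaceOf K μ))
      (c : HilbertBasis (Σ μ : Eigenval K, w μ) ℂ H), ∀ p, c p = b p.1 p.2 := by
  have hsym : (K : H →ₗ[ℂ] H).IsSymmetric := hKs.isSymmetric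
  have hcl (μ : ℂ) : IsClosed (eigenspaceOf K μ : Set H) := by
    have : (eigenspaceOf K μ : Set H) = {x | K x = μ • x} := by
      ext x
      exact Module.End.mem_eigenspace_iff
    rw [this]
    exact isClosed_eq K.continuous (continuous_const_smul μ)
  have hcomp (μ : ℂ) : CompleteSpace (eigenspaceOf K μ) := (hcl μ).completeSpace_coe
  have hex (μ : Eigenval K) : ∃ (w : Set (eigenspaceOf K μ)),
      Nonempty (HilbertBasis w ℂ (eigenspaceOf K μ)) := by
    obtain ⟨w, b, -⟩ := exists_hilbertBasis ℂ (eigenspaceOf K μ)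
    exact ⟨w, ⟨b⟩⟩
  choose w hw using hex
  let b (μ : Eigenval K) : HilbertBasis (w μ) ℂ (eigenspaceOf K μ) := (hw μ).some
  have hon : Orthonormal ℂ fun p : Σ μ : Eigenval K, w μ =>
      ((b p.1 p.2 : eigenspaceOf K p.1) : H) :=
    (hsym.orthogonalFamily_eigenspaces.comp
      (Subtype.val_injective (p := fun μ => Module.End.HasEigenvalue (K : Module.End ℂ H) μ))
      ).orthonormal_sigma_orthonormal fun μ => (b μ).orthonormal
  have hbot : (Submodule.span ℂ (range fun p : Σ μ : Eigenval K, w μ =>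
      ((b p.1 p.2 : eigenspaceOf K p.1) : H)))ᗮ = ⊥ := by
    rw [eq_bot_iff, ← orthogonalComplement_iSup_eigenspaces_eq_bot hK hsym]
    intro x hx
    rw [Submodule.mem_orthogonal]
    have hle : (⨆ μ, Module.End.eigenspace (K : Module.End ℂ H) μ) ≤ (ℂ ∙ x)ᗮ := by
      refine iSup_le fun μ v hv => ?_
      rw [Submodule.mem_orthogonal_singleton_iff_inner_right]
      by_cases hμ : Module.End.HasEigenvalue (K : Module.End ℂ H) μ
      · have h1 := ((b ⟨μ, hμ⟩).hasSum_repr ⟨v, hv⟩).mapL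
          ((innerSL ℂ x).comp (eigenspaceOf K μ).subtypeL)
        have h2 : (fun i => ((innerSL ℂ x).comp (eigenspaceOf K μ).subtypeL)
            ((b ⟨μ, hμ⟩).repr ⟨v, hv⟩ i • b ⟨μ, hμ⟩ i)) = 0 := by
          funext i
          have h3 := (Submodule.mem_orthogonal' _ _).1 hx _
            (Submodule.subset_span ⟨⟨⟨μ, hμ⟩, i⟩, rfl⟩)
          rw [map_smul]
          simp only [comp_apply, innerSL_apply_apply, Submodule.subtypeL_apply]
          rw [h3, smul_zero, Pi.zero_apply]
        rw [h2] at h1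
        exact h1.unique hasSum_zero
      · have : v = 0 := by
          rw [Module.End.hasEigenvalue_iff, not_not] at hμ
          rw [hμ] at hv
          simpa using hv
        simp [this]
    intro v hv
    exact inner_eq_zero_symm.1 ((Submodule.mem_orthogonal_singleton_iff_inner_right).1 (hle hv))
  refine ⟨w, b, HilbertBasis.mkOfOrthogonalEqBot hon hbot, fun p => ?_⟩
  rw [HilbertBasis.coe_mkOfOrthogonalEqBot]

/-! ### The trace formula -/

section Trace

variable {S C D : H →L[ℂ] H} {N : ℝ}

/-- In applications `D = B^(1/2)`, so this bounds the trace norm of `X B Y`. -/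
lemma HSBound.traceNormBound_mul (hDs : IsSelfAdjoint D) (hD : HSBound D N) (X Y : H →L[ℂ] H) :
    TraceNormBound (X * D * (D * Y)) ((‖X‖ ^ 2 * N + ‖Y‖ ^ 2 * N) / 2) := by
  have h1 := hD.mul_right (adjoint X)
  rw [LinearIsometryEquiv.norm_map] at h1
  have := h1.traceNormBound (hD.mul_right Y)
  rwa [← star_eq_adjoint, ← star_eq_adjoint, star_mul, star_star, hDs.star_eq] at this

lemma HSBound.traceNormBound_mul' (hDs : IsSelfAdjoint D) (hD : HSBound D N) (X Y : H →L[ℂ] H) :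
    TraceNormBound (D * X * (Y * D)) ((‖X‖ ^ 2 * N + ‖Y‖ ^ 2 * N) / 2) := by
  have h1 := hD.mul_left (adjoint X)
  rw [LinearIsometryEquiv.norm_map] at h1
  have := h1.traceNormBound (hD.mul_left Y)
  rwa [← star_eq_adjoint, ← star_eq_adjoint, star_mul, star_star, hDs.star_eq] at this

/-- The operator `∫∫ R D² R dτ ds`, where `R = (S + τ C + i s)⁻¹`. -/
noncomputable def stripIntegral (S C D : H →L[ℂ] H) : H →L[ℂ] H :=
  ∫ p, res S C p.1 p.2 * (D * D) * res S C p.1 p.2 ∂stripMeasure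

lemma integrable_norm_res_sq (h : IsUnitSegment S C) :
    Integrable (fun p : ℝ × ℝ => ‖res S C p.1 p.2‖ ^ 2) stripMeasure := by
  obtain ⟨K, -, hK⟩ := exists_norm_res_sq_le h
  refine integrable_stripMeasure (K := K) ((continuousOn_res h).norm.pow 2) fun τ hτ s hs => ?_
  rw [Real.norm_of_nonneg (by positivity)]
  exact hK τ hτ s hs

lemma traceNormBound_stripIntegral (h : IsUnitSegment S C) (hDs : IsSelfAdjoint D)
    (hD : HSBound D N) :
    TraceNormBound (stripIntegral S C D) (∫ p, ‖res S C p.1 p.2‖ ^ 2 * N ∂stripMeasure) := by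
  refine TraceNormBound.integral (integrable_res_mul_res h _)
    ((integrable_norm_res_sq h).mul_const N) (Eventually.of_forall fun p => ?_)
  simpa [mul_assoc] using hD.traceNormBound_mul hDs (res S C p.1 p.2) (res S C p.1 p.2)

lemma integral_strip_res_mul_res (h : IsUnitSegment S C) :
    Integrable (fun p : ℝ × ℝ => res S C p.1 p.2 * res S C p.1 p.2) stripMeasure ∧
    ∫ p, res S C p.1 p.2 * res S C p.1 p.2 ∂stripMeasure =
      -Complex.I • ∫ τ in Ioc (0 : ℝ) 1, res S C τ 0 := by
  have hint : Integrable (fun p : ℝ × ℝ => res S C p.1 p.2 * res S C p.1 p.2) stripMeasure := by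
    simpa using integrable_res_mul_res h 1
  refine ⟨hint, ?_⟩
  rw [stripMeasure, integral_prod _ hint, ← integral_smul]
  exact setIntegral_congr_fun measurableSet_Ioc fun τ hτ =>
    (integral_res_mul_res h (Ioc_subset_Icc_self hτ)).2

/-- By cyclicity, the trace of `∫∫ R D² R dτ ds` is that of `∫∫ D R² D dτ ds`, and
`∫ R² ds = -i (S + τ C)⁻¹`. -/
lemma hasSum_stripIntegral [TopologicalSpace.SeparableSpace H] (h : IsUnitSegment S C)
    (hDs : IsSelfAdjoint D) (hD : HSBound D N) {ι κ : Type u} (b : HilbertBasis ι ℂ H)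
    (c : HilbertBasis κ ℂ H) :
    ∃ t : ℂ, HasSum (fun i => ⟪b i, stripIntegral S C D (b i)⟫_ℂ) t ∧
      HasSum (fun j => -Complex.I *
        ∫ τ in Ioc (0 : ℝ) 1, ⟪c j, D (res S C τ 0 (D (c j)))⟫_ℂ) t := by
  have hint := (integral_strip_res_mul_res h).1
  have h1 := hasSum_inner_integral (integrable_res_mul_res h (D * D))
    ((integrable_norm_res_sq h).mul_const N) (Eventually.of_forall fun p => by
      simpa [mul_assoc] using hD.traceNormBound_mul hDs (res S C p.1 p.2) (res S C p.1 p.2)) b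
  have hint' : Integrable (fun p : ℝ × ℝ => D * res S C p.1 p.2 * (res S C p.1 p.2 * D))
      stripMeasure := by
    simpa [mul_assoc] using (hint.const_mul D).mul_const D
  have h2 := hasSum_inner_integral hint' ((integrable_norm_res_sq h).mul_const N)
    (Eventually.of_forall fun p => by
      simpa using hD.traceNormBound_mul' hDs (res S C p.1 p.2) (res S C p.1 p.2)) c
  have hcyc (p : ℝ × ℝ) :
      ∑' i, ⟪b i, (res S C p.1 p.2 * (D * D) * res S C p.1 p.2) (b i)⟫_ℂ =
        ∑' j, ⟪c j, (D * res S C p.1 p.2 * (res S C p.1 p.2 * D)) (c j)⟫_ℂ := by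
    have := (hD.mul_left (res S C p.1 p.2)).tsum_inner_mul_comm (hD.mul_right (res S C p.1 p.2)) b c
    simpa only [mul_assoc] using this
  simp only [hcyc] at h1
  refine ⟨_, h1, ?_⟩
  convert h2 using 2 with j
  have hD' (x y : H) : ⟪x, D y⟫_ℂ = ⟪D x, y⟫_ℂ := (hDs.isSymmetric x y).symm
  have hres : IntegrableOn (fun τ => res S C τ 0) (Ioc 0 1) := by
    have : ContinuousOn (fun τ => res S C τ 0) (Icc 0 1) :=
      (continuousOn_res h).comp (f := fun τ : ℝ => (τ, (0 : ℝ))) (by fun_prop)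
        fun τ hτ => ⟨hτ, mem_Ici.2 le_rfl⟩
    exact (this.integrableOn_compact isCompact_Icc).mono_set Ioc_subset_Icc_self
  rw [inner_integral_apply hint']
  simp only [mul_apply_eq_comp, hD']
  rw [← inner_integral_apply hres]
  have h3 := inner_integral_apply hint (D (c j)) (D (c j))
  rw [(integral_strip_res_mul_res h).2, smul_apply, inner_smul_right] at h3
  exact h3

end Trace

lemma opLog_pencil_sub_opLog {S B : H →L[ℂ] H} {z : ℂ} (hB : 0 ≤ B)
    (h : IsUnitSegment S (z • B)) : opLog (pencil S B z) - opLog S =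
      (Complex.I * z) • stripIntegral S (z • B) (CFC.sqrt B) := by
  rw [pencil, opLog_sub_opLog h, stripIntegral, CFC.sqrt_mul_sqrt_self B hB, mul_smul,
    ← integral_smul z]
  simp only [mul_smul_comm, smul_mul_assoc]

/-- The trace formula as a sum over an eigenbasis of `K`. -/
lemma hasSum_inner_opLog_sub [TopologicalSpace.SeparableSpace H] {S B : H →L[ℂ] H} {N : ℝ} {z : ℂ}
    (hSinv : IsUnit S) (hB : 0 ≤ B) (hD : HSBound (CFC.sqrt B) N)
    (h : IsUnitSegment S (z • B)) {ι κ : Type u} (b : HilbertBasis ι ℂ H)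
    (c : HilbertBasis κ ℂ H) (l : κ → ℂ) (hc : ∀ j, sandwich S B (c j) = l j • c j) :
    ∃ t : ℂ, HasSum (fun i => ⟪b i, (opLog (pencil S B z) - opLog S) (b i)⟫_ℂ) t ∧
      HasSum (fun j => ∫ τ in (0 : ℝ)..1, z * l j / (1 + τ * z * l j)) t := by
  have hDs : IsSelfAdjoint (CFC.sqrt B) := (CFC.sqrt_nonneg B).isSelfAdjoint
  have hDD : CFC.sqrt B * CFC.sqrt B = B := CFC.sqrt_mul_sqrt_self B hB
  obtain ⟨t, ht1, ht2⟩ := hasSum_stripIntegral h hDs hD b c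
  refine ⟨Complex.I * z * t, ?_, ?_⟩
  · simpa only [opLog_pencil_sub_opLog hB h, smul_apply, inner_smul_right] using
      ht1.mul_left (Complex.I * z)
  · refine (ht2.mul_left (Complex.I * z)).congr_fun fun j => ?_
    rw [intervalIntegral.integral_of_le zero_le_one, ← mul_assoc, ← integral_const_mul]
    refine setIntegral_congr_fun measurableSet_Ioc fun τ hτ => ?_
    have e : shifted S (z • B) τ 0 = S + (τ * z) • (CFC.sqrt B * CFC.sqrt B) := by
      simp [shifted, smul_smul, hDD]
    have hu := h τ (Ioc_subset_Icc_self hτ) 0 le_rfl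
    rw [e] at hu
    have h1 := sandwich_inverse_apply hSinv hu (hc j)
    have h2 := one_add_mul_ne_zero hSinv
      (norm_ne_zero_iff.1 (by simp [c.orthonormal.1 j])) hu (hc j)
    have h3 : ⟪c j, CFC.sqrt B (res S (z • B) τ 0 (CFC.sqrt B (c j)))⟫_ℂ
        = l j / (1 + τ * z * l j) := by
      have h4 := congrArg (fun x => ⟪c j, x⟫_ℂ) h1
      simp only [inner_smul_right, inner_self_eq_norm_sq_to_K, c.orthonormal.1 j] at h4
      rw [res, e, eq_div_iff h2, mul_comm, h4]
      simp
    simp only [h3]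
    rw [mul_right_comm Complex.I z, mul_neg, Complex.I_mul_I]
    ring

lemma isCompactOperator_sandwich {S B : H →L[ℂ] H} {N : ℝ} (hD : HSBound (CFC.sqrt B) N) :
    IsCompactOperator (sandwich S B) :=
  (hD.mul_left _).isCompactOperator

lemma isTraceClass_sandwich {S B : H →L[ℂ] H} {N : ℝ} (hD : HSBound (CFC.sqrt B) N) :
    IsTraceClass (sandwich S B) := by
  have hDs : IsSelfAdjoint (CFC.sqrt B) := (CFC.sqrt_nonneg B).isSelfAdjoint
  have := (hD.traceNormBound_mul' hDs (Ring.inverse S) 1).isTraceClass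
  rwa [one_mul] at this

/-- The terms of a series over an eigenbasis, collected by eigenvalues. -/
lemma hasSum_finrank_mul {K : H →L[ℂ] H} (hK : IsCompactOperator K)
    {w : ∀ μ : Eigenval K, Set (eigenspaceOf K μ)}
    (b : ∀ μ : Eigenval K, HilbertBasis (w μ) ℂ (eigenspaceOf K μ)) {φ : ℂ → ℂ} (hφ : φ 0 = 0)
    {t : ℂ} (h : HasSum (fun p : Σ μ : Eigenval K, w μ => φ p.1) t) :
    HasSum (fun μ : Eigenval K => (Module.finrank ℂ (eigenspaceOf K μ) : ℂ) * φ μ) t := by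
  refine h.sigma fun μ => ?_
  -- the eigenspace of `0` may be infinite-dimensional, but its terms vanish
  by_cases hμ : (μ : ℂ) = 0
  · simp only [hμ, hφ, mul_zero]
    exact hasSum_zero
  · have hfd : FiniteDimensional ℂ (eigenspaceOf K μ) := finite_dimensional_eigenspace hK μ hμ
    have hfin : Finite (w μ) := (b μ).orthonormal.linearIndependent.finite
    have := Fintype.ofFinite (w μ)
    rw [Module.finrank_eq_card_basis (b μ).toOrthonormalBasis.toBasis]
    simpa using hasSum_fintype fun _ : w μ => φ μ

end TraceLog

open TraceLog in
theorem mainTheorem6 {H : Type*} [NormedAddCommGroup H] [InnerProductSpace ℂ H]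
    [CompleteSpace H] [TopologicalSpace.SeparableSpace H]
    (S B : H →L[ℂ] H) (hS : IsSelfAdjoint S) (hSinv : IsUnit S)
    (hB : 0 ≤ B) (hBtr : TraceLog.IsTraceClass B) :
    -- the self-adjoint trace class operator and its eigenvalues
    IsSelfAdjoint (TraceLog.sandwich S B) ∧
    TraceLog.IsTraceClass (TraceLog.sandwich S B) ∧
    (∀ μ : TraceLog.Eigenval (TraceLog.sandwich S B), (μ : ℂ).im = 0 ∧
      ((μ : ℂ) ≠ 0 → FiniteDimensional ℂ (TraceLog.eigenspaceOf (TraceLog.sandwich S B) μ))) ∧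
    ∀ z ∈ TraceLog.admissibleSet S B,
      -- the logarithms and the integrals in the trace formula make sense
      TraceLog.LogDefined S ∧ TraceLog.LogDefined (TraceLog.pencil S B z) ∧
      (∀ μ : TraceLog.Eigenval (TraceLog.sandwich S B), ∀ τ : ℝ, τ ∈ Set.Icc (0 : ℝ) 1 →
        1 + τ * z * (μ : ℂ) ≠ 0) ∧
      -- the difference of the logarithms is trace class, and the trace formula holds
      TraceLog.IsTraceClass (TraceLog.opLog (TraceLog.pencil S B z) - TraceLog.opLog S) ∧
      Summable (fun μ : TraceLog.Eigenval (TraceLog.sandwich S B) =>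
        TraceLog.eigenTerm (TraceLog.sandwich S B) z μ) ∧
      TraceLog.HasTrace (TraceLog.opLog (TraceLog.pencil S B z) - TraceLog.opLog S)
        (∑' μ : TraceLog.Eigenval (TraceLog.sandwich S B),
          TraceLog.eigenTerm (TraceLog.sandwich S B) z μ) := by
  obtain ⟨N, hD⟩ := hBtr.exists_hsBound_sqrt hB
  have hDs : IsSelfAdjoint (CFC.sqrt B) := (CFC.sqrt_nonneg B).isSelfAdjoint
  have hDD : CFC.sqrt B * CFC.sqrt B = B := CFC.sqrt_mul_sqrt_self B hB
  have hKs : IsSelfAdjoint (sandwich S B) := isSelfAdjoint_sandwich hS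
  have hKc : IsCompactOperator (sandwich S B) := isCompactOperator_sandwich hD
  refine ⟨hKs, isTraceClass_sandwich hD, fun μ => ⟨?_, fun hμ => ?_⟩, fun z hz => ?_⟩
  · exact Complex.conj_eq_iff_im.1
      (LinearMap.IsSymmetric.conj_eigenvalue_eq_self hKs.isSymmetric μ.2)
  · exact ContinuousLinearMap.finite_dimensional_eigenspace hKc μ hμ
  have h := isUnitSegment_of_mem_admissibleSet hS hSinv hB hz
  have hTr : IsTraceClass (opLog (pencil S B z) - opLog S) := by
    rw [opLog_pencil_sub_opLog hB h]
    exact ((traceNormBound_stripIntegral h hDs hD).smul _).isTraceClass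
  obtain ⟨w, b, c, hcb⟩ := exists_eigenbasis hKc hKs
  have hc (p : Σ μ : Eigenval (sandwich S B), w μ) : sandwich S B (c p) = (p.1 : ℂ) • c p := by
    rw [hcb]
    exact Module.End.mem_eigenspace_iff.1 (b p.1 p.2).2
  have hsum (ι : Type _) (d : HilbertBasis ι ℂ H) :
      ∃ t : ℂ, HasSum (fun i => inner ℂ (d i) ((opLog (pencil S B z) - opLog S) (d i))) t ∧
        HasSum (fun μ : Eigenval (sandwich S B) => eigenTerm (sandwich S B) z μ) t := by
    obtain ⟨t, ht1, ht2⟩ := hasSum_inner_opLog_sub hSinv hB hD h d c _ hc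
    exact ⟨t, ht1, hasSum_finrank_mul hKc b
      (φ := fun μ => ∫ τ in (0 : ℝ)..1, z * μ / (1 + τ * z * μ)) (by simp) ht2⟩
  refine ⟨logDefined_of_isUnit fun s hs => ?_, logDefined_of_isUnit fun s hs => ?_,
    fun μ τ hτ => ?_, hTr, ?_, hTr, fun ι d => ?_⟩
  · simpa [shifted] using h 0 (by simp) s hs
  · simpa [shifted, pencil] using h 1 (by simp) s hs
  · obtain ⟨x, hx⟩ := μ.2.exists_hasEigenvector
    refine one_add_mul_ne_zero hSinv hx.2 ?_ (Module.End.mem_eigenspace_iff.1 hx.1)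
    simpa [shifted, smul_smul, hDD] using h τ hτ 0 le_rfl
  · obtain ⟨t, -, ht⟩ := hsum _ c
    exact ht.summable
  · obtain ⟨t, ht1, ht2⟩ := hsum ι d
    rwa [ht2.tsum_eq]
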